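/- **Parity games.** A parity game consists of a finite directed graph with vertex set $V$ in which every vertex has an outgoing edge, a partition $V=V_e\cup V_o$ into the vertices of player even and those of player odd, a set of colours $C=\{1,\dots,m\}$ or $C=\{2,\dots,m\}$ (non-empty, $m=\max C$), and a colouring $\phi:V\to C$. Let $e$ be the number of vertices of even colour, and let $C^-=C\setminus\{m\}$ if $m$ is odd and $C^-=C$ if $m$ is even. A play from $v_0$ is an infinite path $v_0v_1v_2\dots$; a strategy of player even chooses, for every finite history that ends in a vertex of $V_e$, a successor of that vertex. Player even wins the parity game from $v_0$ if he has a strategy such that $\limsup_i\phi(v_i)$ is even for all consistent plays from $v_0$. **Sequences.** Consider sequences $\mathbf b=\dots,b_2,b_1,b_0$ with entries that are colours or the blank $\_$, only finitely many of them not blank. Let $\mathrm{even}(\mathbf b)=\{i : b_i \text{ is an even number}\}$. If $\mathbf b$ has no odd entry, let $R(\mathbf b)=\mathrm{even}(\mathbf b)$; otherwise let $R(\mathbf b)=\{i\in\mathrm{even}(\mathbf b): i>o\}\cup\{o\}$, where $o$ is the greatest index of an odd entry. The value is $\mathrm{val}(\mathbf b)=\sum_{i\in R(\mathbf b)}2^i$.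 (If $\mathrm{val}(\mathbf b)\le e$ and $e\geq 1$, then $b_i=\_$ for all $i>\lfloor\log_2 e\rfloor$.) The truncation $\downarrow_1\mathbf b$ keeps, for every odd number, only its leftmost occurrence (the one with the greatest index) in $\mathbf b$ and replaces all its other occurrences by $\_$. There is also a special state $\mathsf{won}$, with $\downarrow_1\mathsf{won}=\mathsf{won}$. **Updates.** For a sequence $\mathbf b$ and a colour $d\in C$, the raw update $\mathrm{ru}'(\mathbf b,d)=\mathbf c$ is given by the first of the following rules that applies (each applies for at most one index $j$). 1. If $d=m$ is odd, then $\mathbf c$ consists of blanks only. 2. (Overflow) If $d$ is even and $j$ is an index such that $b_i$ is even for all $i<j$, $b_j$ is odd or $\_$, and $b_i\ge d$ or $b_i=\_$ for all $i>j$, then $c_i=b_i$ for $i>j$, $c_j=d$, and $c_i=\_$ for $i<j$. 3. (Local) If $j$ is an index such that $d>b_j\ne\_$ and $b_i\ge d$ or $b_i=\_$ for all $i>j$, then $c_i=b_i$ for $i>j$, $c_j=d$ if $j\ne0$ and $c_j=\_$ if $j=0$, and $c_i=\_$ for $i<j$. 4. Otherwise $\mathbf c=\mathbf b$. Let $\mathrm{up}'(\mathbf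 b,d)=\mathrm{ru}'(\mathbf b,d)$ if $\mathrm{val}(\mathrm{ru}'(\mathbf b,d))\le e$, and $\mathrm{up}'(\mathbf b,d)=\mathsf{won}$ otherwise; let $\mathrm{up}'(\mathsf{won},d)=\mathsf{won}$. The concise update is $\mathrm{up}=\downarrow_1\circ\,\mathrm{up}'$. **Concise basic update games.** Starting in $v_0$, the players produce a play as in the parity game, and player even can stop at any time, after any non-empty play prefix $v_0,\dots,v_n$. If he stops, the prefix is evaluated: starting from the sequence $\mathbf b_0$ of blanks, the colours of its vertices are read one by one with $\mathrm{up}$, in the order $v_0,v_1,\dots,v_n$ in the forward game and in the order $v_n,v_{n-1},\dots,v_0$ in the backward game. Player even wins if and only if he stops and the resulting state $\mathbf b_{n+1}$ is $\mathsf{won}$. **Theorem.** For every parity game and every vertex $v_0$, player even has a strategy to win the concise forward basic update game from $v_0$ if and only if he has a strategy to win the parity game from $v_0$; and he has a strategy to win the concise backward basic update game from $v_0$ if and only if he has a strategy to win the parity game from $v_0$. -/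

import Mathlib

namespace ConciseWitness

/-- A parity game on the vertex type `V`. The vertices outside `evenVertices` belong to player
odd. The colours form the set `{1, …, maxColour}` or `{2, …, maxColour}`. -/
structure ParityGame (V : Type*) where
  evenVertices : Set V
  edge : V → V → Prop
  colours : Finset ℕ
  maxColour : ℕ
  maxColour_mem : maxColour ∈ colours
  colours_eq : colours = Finset.Icc 1 maxColour ∨ colours = Finset.Icc 2 maxColour
  colour : V → ℕ
  colour_mem : ∀ v, colour v ∈ colours
  exists_edge : ∀ v, ∃ w, edge v w

/-- A sequence `…, b₂, b₁, b₀` over the colours and the blank symbol (`none`), of arbitrary length: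
only finitely many entries are different from blank. -/
@[ext]
structure WitnessSeq where
  entry : ℕ → Option ℕ
  finite_entry : {i | entry i ≠ none}.Finite

namespace WitnessSeq

/-- The sequence that has only blanks. -/
def blank : WitnessSeq where
  entry := fun _ => none
  finite_entry := by simp

/-- `b_i` is an even number. -/
def EvenAt (b : WitnessSeq) (i : ℕ) : Prop := ∃ c, b.entry i = some c ∧ Even c

/-- `b_i` is an odd number. -/
def OddAt (b : WitnessSeq) (i : ℕ) : Prop := ∃ c, b.entry i = some c ∧ Odd c

/-- The relevant positions: the greatest position `o` of an odd number (if there is one), and all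
positions of even numbers (that are greater than `o`, if there is such an `o`). -/
def relevant (b : WitnessSeq) : Set ℕ :=
  {i | (b.EvenAt i ∧ ∀ o, b.OddAt o → o < i) ∨ (b.OddAt i ∧ ∀ o, b.OddAt o → o ≤ i)}

/-- The value of a sequence: the sum of `2 ^ i` over the (finitely many) relevant positions. -/
noncomputable def val (b : WitnessSeq) : ℕ := ∑ᶠ i ∈ b.relevant, 2 ^ i

/-- Keep the entries at the positions `> j`, write `x` at position `j`, and replace all entries at
the positions `< j` by blanks. -/
def overwrite (b : WitnessSeq) (j : ℕ) (x : Option ℕ) : WitnessSeq where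
  entry := fun i => if j < i then b.entry i else if i = j then x else none
  finite_entry := by
    refine (b.finite_entry.insert j).subset fun i hi => ?_
    simp only [Set.mem_ofPred_eq] at hi
    split_ifs at hi with h1 h2
    · exact Or.inr hi
    · exact Or.inl h2
    · exact absurd rfl hi

/-- The truncation operator `↓₁`: of every odd number, only the leftmost occurrence (the one with
the greatest index) is kept, all other occurrences are replaced by blanks. -/
noncomputable def trunc (b : WitnessSeq) : WitnessSeq where
  entry := fun i =>
    open Classical in if b.OddAt i ∧ ∃ j, i < j ∧ b.entry j = b.entry i then none else b.entry i
  finite_entry := by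
    refine b.finite_entry.subset fun i hi => ?_
    simp only [Set.mem_ofPred_eq] at hi
    split_ifs at hi with h
    · exact absurd rfl hi
    · exact hi

/-- All entries at the positions `> j` are blank or at least `d`. -/
def GeAbove (b : WitnessSeq) (d j : ℕ) : Prop :=
  ∀ i, j < i → ∀ c, b.entry i = some c → d ≤ c

/-- The overflow rule applies at position `j`: `d` is even, all `b_i` with `i < j` are even numbers,
`b_j` is odd or blank, and all `b_i` with `i > j` are at least `d` or blank. -/
def OverflowAt (b : WitnessSeq) (d j : ℕ) : Prop :=
  Even d ∧ (∀ i, i < j → b.EvenAt i) ∧ (b.OddAt j ∨ b.entry j = none) ∧ b.GeAbove d j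

/-- The local rule applies at position `j`: `b_j` is not blank and `b_j < d`, and all `b_i` with
`i > j` are at least `d` or blank. -/
def LocalAt (b : WitnessSeq) (d j : ℕ) : Prop :=
  (∃ c, b.entry j = some c ∧ c < d) ∧ b.GeAbove d j

end WitnessSeq

/-- The states of the update automaton: sequences, and the special state `won`. -/
inductive State where
  | seq (b : WitnessSeq) : State
  | won : State

/-- Truncation on states, with `↓₁ won = won`. -/
noncomputable def State.trunc : State → State
  | .seq b => .seq b.trunc
  | .won => .won

namespace ParityGame

variable {V : Type*} (G : ParityGame V)

/-- `C⁻`: the colours without the greatest colour if that one is odd, and all colours otherwise. -/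
def coloursMinus : Finset ℕ :=
  if Odd G.maxColour then G.colours.erase G.maxColour else G.colours

/-- The number of vertices of even colour. -/
noncomputable def numEven : ℕ := Nat.card {v : V // Even (G.colour v)}

/-- The classic raw update `ru'`. For `d ∈ C⁻`, the overflow rule is used if it applies, otherwise
the local rule if it applies, and otherwise the sequence stays as it is; each rule applies at one
position at most. If `d` is the greatest colour and odd, then the sequence is reset. -/
noncomputable def rawUpdateClassic (b : WitnessSeq) (d : ℕ) : WitnessSeq :=
  open Classical in
  if d ∈ G.coloursMinus then
    if h : ∃ j, b.OverflowAt d j then b.overwrite h.choose (some d)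
    else if h : ∃ j, b.LocalAt d j then
      b.overwrite h.choose (if h.choose = 0 then none else some d)
    else b
  else WitnessSeq.blank

/-- The classic update `up'`: the raw update, unless its value exceeds the number of vertices of
even colour, in which case the result is `won`. The state `won` is a sink. -/
noncomputable def updateClassic : State → ℕ → State
  | .seq b, d =>
    if (G.rawUpdateClassic b d).val ≤ G.numEven then .seq (G.rawUpdateClassic b d) else .won
  | .won, _ => .won

/-- The concise update `up = ↓₁ ∘ up'`. -/
noncomputable def update (s : State) (d : ℕ) : State := (G.updateClassic s d).trunc

/-- The state that is reached from the sequence of blanks by reading the colours of the vertices in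
the list from left to right with the concise update. -/
noncomputable def eval (ρ : List V) : State :=
  ρ.foldl (fun s v => G.update s (G.colour v)) (.seq WitnessSeq.blank)

/-- A play that starts in `v₀`. -/
def IsPlay (v₀ : V) (π : ℕ → V) : Prop := π 0 = v₀ ∧ ∀ n, G.edge (π n) (π (n + 1))

/-- A strategy of player even: `σ ρ v` is his choice in `v` after the history `ρ`. Its values at
the vertices of player odd are irrelevant. -/
def IsStrategy (σ : List V → V → V) : Prop := ∀ ρ, ∀ v ∈ G.evenVertices, G.edge v (σ ρ v)

/-- The play `π` is consistent with the strategy `σ` of player even. -/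
def Consistent (σ : List V → V → V) (π : ℕ → V) : Prop :=
  ∀ n, π n ∈ G.evenVertices → π (n + 1) = σ ((List.range n).map π) (π n)

/-- Player even wins the parity game from `v₀`. -/
def EvenWinsParity (v₀ : V) : Prop :=
  ∃ σ, G.IsStrategy σ ∧ ∀ π, G.IsPlay v₀ π → G.Consistent σ π →
    Even (Filter.limsup (fun i => G.colour (π i)) Filter.atTop)

/-- Player even wins, from `v₀`, the game in which he can stop after every nonempty play prefix, and
has won if the prefix with which he stops is in `W`. A strategy consists of a strategy `σ` for his
moves and of the set `halt` of the prefixes with which he stops; never to stop is losing. -/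
def EvenWinsStopping (W : List V → Prop) (v₀ : V) : Prop :=
  ∃ (σ : List V → V → V) (halt : Set (List V)), G.IsStrategy σ ∧
    ∀ π, G.IsPlay v₀ π → G.Consistent σ π →
      ∃ n, (List.range (n + 1)).map π ∈ halt ∧ (∀ m < n, (List.range (m + 1)).map π ∉ halt) ∧
        W ((List.range (n + 1)).map π)

/-- Player even wins the concise forward basic update game from `v₀`: the prefix `v₀, …, vₙ` is
read from left to right. -/
def EvenWinsForward (v₀ : V) : Prop :=
  G.EvenWinsStopping (fun ρ => G.eval ρ = .won) v₀

/-- Player even wins the concise backward basic update game from `v₀`: the prefix `v₀, …, vₙ` is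
read from right to left. -/
def EvenWinsBackward (v₀ : V) : Prop :=
  G.EvenWinsStopping (fun ρ => G.eval ρ.reverse = .won) v₀

end ParityGame

end ConciseWitness

/-! Call a segment of a path an even cycle if its two ends are the same vertex and its maximal
colour is even.

From an update game to the parity game: a non-blank entry at position `i` certifies a chain of `2 ^
i` positions such that the maximal colour between any two of them is even (`WitnessSeq.Sound`). The
chains at the relevant positions concatenate to one of length `val`, so a value above the number of
even-coloured vertices makes some vertex occur twice in the chain. Thus `won` yields an even cycle
(`sound_eval`), also in the backward game, because the reverse of an even cycle is an even cycle. A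
strategy that enforces an even cycle in every play is then turned into a winning one: play it on a
stack from which even cycles are cut out as soon as they close (`forgetful`). The height cannot tend
to infinity, since the limit of the stacks would be a consistent play without an even cycle. So the
stack returns infinitely often to some height `H` below which it eventually never falls. A limes
superior `C` that is odd would leave an entry of colour `C` above `H` that only a cycle with maximal
colour `C` could remove (`even_limsup_of_forgetful`).

From the parity game to an update game: let `c` be the even limes superior of a play. Until `won` is
reached, a bounded potential never decreases on colours at most `c` and increases on `c`
(`update_eq_won_or`). Hence a segment with enough occurrences of `c` and nothing greater leads from
any state to `won`. The forward game reads such a segment last; the backward game reads it first and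
then stays in the sink `won`. -/

namespace ConciseWitness

/-! ### Segment maxima and even chains -/

/-- The maximum of `c` on `[p, q)`. -/
def segMax (c : ℕ → ℕ) (p q : ℕ) : ℕ := (Finset.Ico p q).sup c

lemma segMax_succ (c : ℕ → ℕ) {p q : ℕ} (h : p ≤ q) :
    segMax c p (q + 1) = max (segMax c p q) (c q) := by
  unfold segMax
  rw [← Finset.insert_Ico_right_eq_Ico_add_one h, Finset.sup_insert, max_comm]

lemma segMax_self (c : ℕ → ℕ) (p : ℕ) : segMax c p (p + 1) = c p := by
  simp [segMax]

/-- Two segments that overlap or touch. -/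
lemma segMax_union (c : ℕ → ℕ) {p q r s : ℕ} (h1 : p ≤ r) (h2 : r ≤ q) (h3 : q ≤ s) :
    segMax c p s = max (segMax c p q) (segMax c r s) := by
  unfold segMax
  rw [← Finset.sup_union]
  congr 1
  ext x
  simp only [Finset.mem_union, Finset.mem_Ico]
  omega

lemma segMax_congr {c c' : ℕ → ℕ} {p q : ℕ} (h : ∀ i, p ≤ i → i < q → c i = c' i) :
    segMax c p q = segMax c' p q :=
  Finset.sup_congr rfl fun i hi => by
    rw [Finset.mem_Ico] at hi
    exact h i hi.1 hi.2

lemma even_max {a b : ℕ} (ha : Even a) (hb : Even b) : Even (max a b) := by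
  rcases max_choice a b with h | h <;> rwa [h]

/-- A chain of `k` positions from `p` to `q`, such that the maximal colour between any two of them
(inclusively) is even. -/
def EvenChain (c : ℕ → ℕ) (p q k : ℕ) : Prop :=
  ∃ S : Finset ℕ, S.card = k ∧ p ∈ S ∧ q ∈ S ∧ (∀ x ∈ S, p ≤ x ∧ x ≤ q) ∧
    ∀ x ∈ S, ∀ y ∈ S, x ≤ y → Even (segMax c x (y + 1))

lemma EvenChain.single {c : ℕ → ℕ} {p : ℕ} (h : Even (c p)) : EvenChain c p p 1 :=
  ⟨{p}, by simp, by simp, by simp, by simp, by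
    intro x hx y hy _
    rw [Finset.mem_singleton] at hx hy
    subst hx hy
    rwa [segMax_self]⟩

/-- Between positions of different chains, the segment is the union of three overlapping ones that
meet at `q` and `p'`; each has an even maximum. -/
lemma EvenChain.append {c : ℕ → ℕ} {p q k p' q' k' : ℕ} (h : EvenChain c p q k)
    (h' : EvenChain c p' q' k') (hlt : q < p') (hev : Even (segMax c q (p' + 1))) :
    EvenChain c p q' (k + k') := by
  obtain ⟨S, hc, hp, hq, hb, he⟩ := h
  obtain ⟨S', hc', hp', hq', hb', he'⟩ := h'
  refine ⟨S ∪ S', ?_, by simp [hp], by simp [hq'], ?_, ?_⟩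
  · rw [Finset.card_union_of_disjoint, hc, hc']
    rw [Finset.disjoint_left]
    intro x hx hx'
    have := hb x hx
    have := hb' x hx'
    omega
  · intro x hx
    have h1 := hb _ hq
    have h2 := hb' _ hq'
    have h3 := hb _ hp
    have h4 := hb' _ hp'
    rcases Finset.mem_union.1 hx with hx | hx
    · have := hb x hx
      omega
    · have := hb' x hx
      omega
  · intro x hx y hy hxy
    rcases Finset.mem_union.1 hx with hx | hx <;> rcases Finset.mem_union.1 hy with hy | hy
    · exact he x hx y hy hxy
    · have h1 := hb x hx
      have h2 := hb' y hy
      rw [segMax_union c (p := x) (q := p' + 1) (r := p') (by omega) (by omega) (by omega),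
        segMax_union c (p := x) (q := q + 1) (r := q) (by omega) (by omega) (by omega)]
      exact even_max (even_max (he x hx q hq h1.2) hev) (he' p' hp' y hy h2.1)
    · have h1 := hb' x hx
      have h2 := hb y hy
      omega
    · exact he' x hx y hy hxy

/-! ### Soundness: entries as certificates for even chains -/

namespace WitnessSeq

/-- After reading `c 0, …, c (n - 1)`, every non-blank entry at position `i` stands for a chain of
length `2 ^ i`, and the entry is the maximal colour since the end of that chain. -/
def Sound (c : ℕ → ℕ) (n : ℕ) (b : WitnessSeq) : Prop :=
  ∃ F L : ℕ → ℕ, ∀ i x, b.entry i = some x →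
    EvenChain c (F i) (L i) (2 ^ i) ∧ L i < n ∧ segMax c (L i) n = x ∧
    ∀ j < i, ∀ y, b.entry j = some y → L i < F j ∧ segMax c (L i) (F j + 1) = x

variable {c : ℕ → ℕ} {n : ℕ} {b : WitnessSeq}

lemma Sound.blank : Sound c n WitnessSeq.blank :=
  ⟨id, id, fun i x h => by simp [WitnessSeq.blank] at h⟩

/-- The invariant constrains non-blank entries only, so blanking entries cannot violate it. -/
lemma Sound.trunc (h : Sound c n b) : Sound c n b.trunc := by
  have key : ∀ i x, b.trunc.entry i = some x → b.entry i = some x := by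
    intro i x hx
    simp only [WitnessSeq.trunc] at hx
    split_ifs at hx
    exact hx
  obtain ⟨F, L, hFL⟩ := h
  refine ⟨F, L, fun i x hx => ?_⟩
  obtain ⟨h1, h2, h3, h4⟩ := hFL i x (key i x hx)
  exact ⟨h1, h2, h3, fun j hj y hy => h4 j hj y (key j y hy)⟩

/-- Chains at several positions are concatenated. -/
lemma exists_evenChain {F L : ℕ → ℕ} (h : ∀ i x, b.entry i = some x →
    EvenChain c (F i) (L i) (2 ^ i) ∧ L i < n ∧ segMax c (L i) n = x ∧
    ∀ j < i, ∀ y, b.entry j = some y → L i < F j ∧ segMax c (L i) (F j + 1) = x)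
    (T : Finset ℕ) : T.Nonempty → (∀ i ∈ T, b.entry i ≠ none) →
    (∀ i ∈ T, b.EvenAt i ∨ ∀ k ∈ T, i ≤ k) →
    ∃ i ∈ T, ∃ k ∈ T, EvenChain c (F i) (L k) (∑ i ∈ T, 2 ^ i) := by
  induction T using Finset.induction_on_max with
  | empty => simp
  | insert j T hj ih =>
    intro _ hne hev
    have hjT : j ∉ T := fun hjT => lt_irrefl _ (hj j hjT)
    obtain ⟨x, hx⟩ := Option.ne_none_iff_exists'.1 (hne j (by simp))
    obtain ⟨h1, h2, h3, h4⟩ := h j x hx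
    rcases T.eq_empty_or_nonempty with rfl | hT
    · exact ⟨j, by simp, j, by simp, by simpa using h1⟩
    · obtain ⟨i, hi, k, hk, hik⟩ := ih hT (fun i hi => hne i (by simp [hi])) (fun i hi => by
        rcases hev i (by simp [hi]) with h | h
        · exact Or.inl h
        · exact Or.inr fun k hk => h k (by simp [hk]))
      obtain ⟨y, hy⟩ := Option.ne_none_iff_exists'.1 (hne i (by simp [hi]))
      obtain ⟨h5, h6⟩ := h4 i (hj i hi) y hy
      refine ⟨j, by simp, k, by simp [hk], ?_⟩
      rw [Finset.sum_insert hjT]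
      refine h1.append hik h5 ?_
      rw [h6]
      -- The entry at `j` is the maximum across the gap to the next chain. Only the rightmost
      -- position may have an odd entry, because no gap follows it; `j` is not rightmost here.
      rcases hev j (by simp) with ⟨x', hx', he⟩ | hmin
      · rw [hx] at hx'
        cases hx'
        exact he
      · have := hmin i (by simp [hi])
        have := hj i hi
        omega

lemma finite_relevant (b : WitnessSeq) : b.relevant.Finite := by
  refine b.finite_entry.subset fun i hi => ?_
  rcases hi with ⟨⟨x, hx, _⟩, _⟩ | ⟨⟨x, hx, _⟩, _⟩ <;> simp [hx]

lemma val_eq_sum (b : WitnessSeq) : b.val = ∑ i ∈ b.finite_relevant.toFinset, 2 ^ i :=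
  finsum_mem_eq_finite_toFinset_sum _ _

/-- The greatest odd position is the least relevant one, so its chain comes last in the
concatenation and every gap has an even maximum. -/
lemma Sound.exists_evenChain_val (h : Sound c n b) (hv : 0 < b.val) :
    ∃ p q, q < n ∧ EvenChain c p q b.val := by
  obtain ⟨F, L, hFL⟩ := h
  have hmem : ∀ i ∈ b.finite_relevant.toFinset, b.entry i ≠ none := by
    intro i hi
    rw [Set.Finite.mem_toFinset] at hi
    rcases hi with ⟨⟨x, hx, _⟩, _⟩ | ⟨⟨x, hx, _⟩, _⟩ <;> simp [hx]
  rw [val_eq_sum] at hv ⊢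
  obtain ⟨i, hi, k, hk, hc⟩ := exists_evenChain hFL b.finite_relevant.toFinset
    (by
      by_contra hne
      rw [Finset.not_nonempty_iff_eq_empty] at hne
      rw [hne] at hv
      simp at hv) hmem
    (by
      intro i hi
      rw [Set.Finite.mem_toFinset] at hi
      rcases hi with hi | hi
      · exact Or.inl hi.1
      · refine Or.inr fun k hk => ?_
        rw [Set.Finite.mem_toFinset] at hk
        rcases hk with hk | hk
        · exact (hk.2 i hi.1).le
        · exact hk.2 i hi.1)
  obtain ⟨x, hx⟩ := Option.ne_none_iff_exists'.1 (hmem k hk)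
  exact ⟨F i, L k, (hFL k x hx).2.1, hc⟩

lemma overwrite_entry (b : WitnessSeq) (j : ℕ) (x : Option ℕ) (i : ℕ) :
    (b.overwrite j x).entry i = if j < i then b.entry i else if i = j then x else none := rfl

/-- The chains at the positions below `j` have total length `2 ^ j - 1`; the current position
completes them to a chain of length `2 ^ j`. The old chain at `j`, if any, is dropped. -/
lemma Sound.overflow (h : Sound c n b) {j : ℕ} (hj : b.OverflowAt (c n) j) :
    Sound c (n + 1) (b.overwrite j (some (c n))) := by
  obtain ⟨F, L, hFL⟩ := h
  obtain ⟨hd, hlow, -, hge⟩ := hj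
  -- The start `p` of the new chain is `n` itself or the start of an old chain below `j`; this gives
  -- the gap condition for the chains to the left of `j`.
  obtain ⟨p, hp, hpF, hpn⟩ : ∃ p, EvenChain c p n (2 ^ j) ∧
      (p = n ∨ ∃ i < j, p = F i) ∧ p ≤ n := by
    rcases Nat.eq_zero_or_pos j with rfl | hj0
    · exact ⟨n, EvenChain.single hd, Or.inl rfl, le_rfl⟩
    · obtain ⟨i, hi, k, hk, hik⟩ := exists_evenChain hFL (Finset.range j) (by simpa using hj0.ne')
        (fun i hi => by
          obtain ⟨x, hx, _⟩ := hlow i (Finset.mem_range.1 hi)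
          simp [hx]) (fun i hi => Or.inl (hlow i (Finset.mem_range.1 hi)))
      obtain ⟨x, hx, hxe⟩ := hlow k (Finset.mem_range.1 hk)
      obtain ⟨-, h2, h3, -⟩ := hFL k x hx
      have hch := hik.append (EvenChain.single hd) h2 (by
        rw [segMax_succ c h2.le, h3]
        exact even_max hxe hd)
      have hsum : ∑ i ∈ Finset.range j, 2 ^ i + 1 = 2 ^ j := by
        rw [Nat.geomSum_eq le_rfl]
        have := Nat.one_le_two_pow (n := j)
        simp only [Nat.add_one_sub_one, Nat.div_one]
        omega
      rw [hsum] at hch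
      refine ⟨F i, hch, Or.inr ⟨i, Finset.mem_range.1 hi, rfl⟩, ?_⟩
      obtain ⟨S, _, h5, _, h6, _⟩ := hch
      exact (h6 _ h5).2
  refine ⟨fun i => if i = j then p else F i, fun i => if i = j then n else L i, ?_⟩
  intro i x hx
  rw [overwrite_entry] at hx
  split_ifs at hx with h1 h2
  · obtain ⟨h3, h4, h5, h6⟩ := hFL i x hx
    have hdx := hge i h1 x hx
    have hmx : segMax c (L i) (n + 1) = x := by
      rw [segMax_succ c h4.le, h5, max_eq_left hdx]
    simp only [h1.ne', if_false]
    refine ⟨h3, h4.trans (Nat.lt_succ_self n), hmx, fun k hk y hy => ?_⟩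
    rw [overwrite_entry] at hy
    split_ifs at hy with h7 h8
    · simp only [h7.ne', if_false]
      exact h6 k hk y hy
    · simp only [h8, if_true]
      rcases hpF with rfl | ⟨i', hi', rfl⟩
      · exact ⟨h4, hmx⟩
      · obtain ⟨z, hz, _⟩ := hlow i' hi'
        exact h6 i' (by omega) z hz
  · cases hx
    subst h2
    simp only [if_true]
    refine ⟨hp, Nat.lt_succ_self n, segMax_self c n, fun k hk y hy => ?_⟩
    rw [overwrite_entry] at hy
    split_ifs at hy <;> omega

/-- Serves both forms of the local rule. The chain at `j` is kept, and only the maximum since its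
end rises to `c n`. -/
lemma Sound.of_geAbove (h : Sound c n b) {j : ℕ} (hge : b.GeAbove (c n) j) {x' : Option ℕ}
    (hj : ∀ x, x' = some x → x = c n ∧ ∃ y, b.entry j = some y ∧ y ≤ c n) :
    Sound c (n + 1) (b.overwrite j x') := by
  obtain ⟨F, L, hFL⟩ := h
  refine ⟨F, L, fun i x hx => ?_⟩
  have hlower : ∀ k < i, ∀ y, (b.overwrite j x').entry k = some y → ∃ z, b.entry k = some z := by
    intro k _ y hy
    rw [overwrite_entry] at hy
    split_ifs at hy with h1 h2
    · exact ⟨y, hy⟩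
    · obtain ⟨_, z, hz, _⟩ := hj y hy
      exact ⟨z, h2 ▸ hz⟩
  rw [overwrite_entry] at hx
  split_ifs at hx with h1 h2
  · obtain ⟨h3, h4, h5, h6⟩ := hFL i x hx
    refine ⟨h3, by omega, ?_, fun k hk y hy => ?_⟩
    · rw [segMax_succ c h4.le, h5, max_eq_left (hge i h1 x hx)]
    · obtain ⟨z, hz⟩ := hlower k hk y hy
      exact h6 k hk z hz
  · subst h2
    obtain ⟨rfl, z, hz, hzx⟩ := hj x hx
    obtain ⟨h3, h4, h5, h6⟩ := hFL i z hz
    refine ⟨h3, by omega, ?_, fun k hk y hy => ?_⟩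
    · rw [segMax_succ c h4.le, h5, max_eq_right hzx]
    -- Vacuous, as everything further right is now blank. Entries there could not be kept in
    -- general: the recorded colour has changed, but the maxima up to the later chains have not.
    · rw [overwrite_entry] at hy
      split_ifs at hy <;> omega

/-- If some entry is less than `d`, then the local rule applies at the leftmost such position. -/
lemma exists_localAt {b : WitnessSeq} {d i x : ℕ} (hx : b.entry i = some x) (hlt : x < d) :
    ∃ j, i ≤ j ∧ b.LocalAt d j := by
  have hfin : {i | ∃ x, b.entry i = some x ∧ x < d}.Finite := by
    refine b.finite_entry.subset fun i hi => ?_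
    obtain ⟨x, hx, _⟩ := hi
    simp [hx]
  obtain ⟨j, hj, hmax⟩ := hfin.exists_le_maximal ⟨x, hx, hlt⟩
  refine ⟨j, hj, hmax.1, fun k hk y hy => ?_⟩
  by_contra hlt
  exact absurd (hmax.2 ⟨y, hy, not_le.1 hlt⟩ hk.le) (not_le.2 hk)

lemma Sound.of_forall_le (h : Sound c n b) (hge : ∀ i x, b.entry i = some x → c n ≤ x) :
    Sound c (n + 1) b := by
  obtain ⟨F, L, hFL⟩ := h
  refine ⟨F, L, fun i x hx => ?_⟩
  obtain ⟨h3, h4, h5, h6⟩ := hFL i x hx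
  refine ⟨h3, by omega, ?_, h6⟩
  rw [segMax_succ c h4.le, h5, max_eq_left (hge i x hx)]

end WitnessSeq

/-! ### From `won` to an even cycle -/

namespace ParityGame

variable {V : Type*} (G : ParityGame V)

lemma sound_rawUpdateClassic {c : ℕ → ℕ} {n : ℕ} {b : WitnessSeq} (h : b.Sound c n) :
    (G.rawUpdateClassic b (c n)).Sound c (n + 1) := by
  unfold rawUpdateClassic
  split_ifs with h1 h2 h3 h4
  · exact h.overflow h2.choose_spec
  · exact h.of_geAbove h3.choose_spec.2 (by simp)
  · obtain ⟨⟨y, hy, hlt⟩, hge⟩ := h3.choose_spec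
    exact h.of_geAbove hge fun x hx => ⟨by simpa using hx.symm, y, hy, hlt.le⟩
  · refine h.of_forall_le fun i x hx => ?_
    by_contra hlt
    obtain ⟨j, -, hj⟩ := WitnessSeq.exists_localAt hx (not_le.1 hlt)
    exact h3 ⟨j, hj⟩
  · exact WitnessSeq.Sound.blank

lemma eval_append (l l' : List V) :
    G.eval (l ++ l') = l'.foldl (fun s v => G.update s (G.colour v)) (G.eval l) := by
  simp [eval, List.foldl_append]

lemma eval_map_range_succ (f : ℕ → V) (n : ℕ) :
    G.eval ((List.range (n + 1)).map f) =
      G.update (G.eval ((List.range n).map f)) (G.colour (f n)) := by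
  rw [List.range_succ, List.map_append, eval_append]
  rfl

/-- A segment of `f` from `x` to `y` that is a cycle with an even maximal colour. -/
def EvenCycle (f : ℕ → V) (x y : ℕ) : Prop :=
  x < y ∧ f x = f y ∧ Even (segMax (fun i => G.colour (f i)) x (y + 1))

/-- Pigeonhole: every position of the chain has an even colour, and there are more positions than
vertices of even colour. -/
lemma exists_evenCycle_of_evenChain [Finite V] {f : ℕ → V} {p q k : ℕ}
    (h : EvenChain (fun i => G.colour (f i)) p q k) (hk : G.numEven < k) :
    ∃ x y, y ≤ q ∧ G.EvenCycle f x y := by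
  obtain ⟨S, hc, -, -, hb, he⟩ := h
  have hev : ∀ x ∈ S, Even (G.colour (f x)) := fun x hx => by
    have := he x hx x hx le_rfl
    rwa [segMax_self] at this
  have hnotinj : ¬ Function.Injective
      (fun x : S => (⟨f x, hev x x.2⟩ : {v : V // Even (G.colour v)})) := by
    intro hinj
    have := Nat.card_le_card_of_injective _ hinj
    rw [Nat.card_eq_fintype_card, Fintype.card_coe, hc] at this
    exact absurd this (not_le.2 hk)
  simp only [Function.Injective, not_forall] at hnotinj
  obtain ⟨⟨x, hx⟩, ⟨y, hy⟩, hxy, hne⟩ := hnotinj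
  simp only [Subtype.mk.injEq] at hxy hne
  rcases lt_or_gt_of_ne hne with hlt | hlt
  · exact ⟨x, y, (hb y hy).2, hlt, hxy, he x hx y hy hlt.le⟩
  · exact ⟨y, x, (hb x hx).2, hlt, hxy.symm, he y hy x hx hlt.le⟩

lemma sound_eval [Finite V] (f : ℕ → V) (n : ℕ) :
    (∃ x y, y < n ∧ G.EvenCycle f x y) ∨
      ∃ b, G.eval ((List.range n).map f) = .seq b ∧ b.Sound (fun i => G.colour (f i)) n := by
  induction n with
  | zero => exact Or.inr ⟨_, rfl, WitnessSeq.Sound.blank⟩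
  | succ n ih =>
    rcases ih with ⟨x, y, hy, hxy⟩ | ⟨b, hb, hs⟩
    · exact Or.inl ⟨x, y, by omega, hxy⟩
    · rw [eval_map_range_succ, hb]
      have hs' := G.sound_rawUpdateClassic hs
      by_cases hv : (G.rawUpdateClassic b (G.colour (f n))).val ≤ G.numEven
      · refine Or.inr ⟨(G.rawUpdateClassic b (G.colour (f n))).trunc, ?_, hs'.trunc⟩
        simp [update, updateClassic, hv, State.trunc]
      · obtain ⟨p, q, hq, hch⟩ := hs'.exists_evenChain_val (by omega)
        obtain ⟨x, y, hy, hxy⟩ := G.exists_evenCycle_of_evenChain hch (not_le.1 hv)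
        exact Or.inl ⟨x, y, by omega, hxy⟩

lemma exists_evenCycle_of_eval_eq_won [Finite V] {f : ℕ → V} {n : ℕ}
    (h : G.eval ((List.range n).map f) = .won) : ∃ x y, y < n ∧ G.EvenCycle f x y := by
  rcases G.sound_eval f n with h' | ⟨b, hb, -⟩
  · exact h'
  · rw [h] at hb
    cases hb

lemma reverse_map_range_succ (f : ℕ → V) (n : ℕ) :
    ((List.range (n + 1)).map f).reverse = (List.range (n + 1)).map fun i => f (n - i) := by
  apply List.ext_getElem
  · simp
  · intro i h1 h2
    simp at h1 ⊢

lemma exists_evenCycle_of_eval_reverse_eq_won [Finite V] {f : ℕ → V} {n : ℕ}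
    (h : G.eval ((List.range (n + 1)).map f).reverse = .won) :
    ∃ x y, y < n + 1 ∧ G.EvenCycle f x y := by
  rw [reverse_map_range_succ] at h
  obtain ⟨x, y, hy, hxy, he, hev⟩ := G.exists_evenCycle_of_eval_eq_won h
  -- Reversal `i ↦ n - i` swaps the ends; `y < n + 1` keeps the subtraction from being cut off at
  -- `0`.
  refine ⟨n - y, n - x, by omega, by omega, he.symm, ?_⟩
  convert hev using 1
  apply le_antisymm
  · refine Finset.sup_le fun i hi => ?_
    rw [Finset.mem_Ico] at hi
    have := Finset.le_sup (f := fun i => G.colour (f (n - i))) (s := Finset.Ico x (y + 1))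
      (b := n - i) (by rw [Finset.mem_Ico]; omega)
    rwa [show n - (n - i) = i by omega] at this
  · refine Finset.sup_le fun i hi => ?_
    rw [Finset.mem_Ico] at hi
    exact Finset.le_sup (f := fun i => G.colour (f i)) (s := Finset.Ico (n - y) (n - x + 1))
      (b := n - i) (by rw [Finset.mem_Ico]; omega)

end ParityGame
-- From enforced even cycles to a win in the parity game
namespace ParityGame

variable {V : Type*} (G : ParityGame V)

lemma colour_le_maxColour (v : V) : G.colour v ≤ G.maxColour := by
  have := G.colour_mem v
  rcases G.colours_eq with h | h <;> rw [h, Finset.mem_Icc] at this <;> exact this.2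

/-- The limes superior of the colours of a play is an upper bound of all colours from some time on,
and occurs again and again. -/
lemma limsup_colour (π : ℕ → V) :
    (∃ T, ∀ t ≥ T, G.colour (π t) ≤ Filter.limsup (fun i => G.colour (π i)) Filter.atTop) ∧
    ∀ T, ∃ t ≥ T, G.colour (π t) = Filter.limsup (fun i => G.colour (π i)) Filter.atTop := by
  set C := Filter.limsup (fun i => G.colour (π i)) Filter.atTop with hC
  have hbdd : Filter.IsBoundedUnder (· ≤ ·) Filter.atTop (fun i => G.colour (π i)) :=
    Filter.isBoundedUnder_of ⟨G.maxColour, fun i => G.colour_le_maxColour _⟩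
  have hcob : Filter.IsCoboundedUnder (· ≤ ·) Filter.atTop (fun i => G.colour (π i)) :=
    Filter.IsCoboundedUnder.of_frequently_ge (a := 0) (Filter.Frequently.of_forall fun _ => zero_le)
  have h1 : ∃ T, ∀ t ≥ T, G.colour (π t) ≤ C := by
    have := Filter.eventually_lt_of_limsup_lt (u := fun i => G.colour (π i)) (b := C + 1)
      (by rw [← hC]; exact Nat.lt_succ_self C) hbdd
    obtain ⟨T, hT⟩ := Filter.eventually_atTop.1 this
    exact ⟨T, fun t ht => Nat.lt_succ_iff.1 (hT t ht)⟩
  refine ⟨h1, fun T => ?_⟩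
  obtain ⟨T1, hT1⟩ := h1
  -- For `C = 0` there is no strict lower bound `C - 1`; then all late colours are `0` anyway.
  rcases Nat.eq_zero_or_pos C with h0 | hpos
  · exact ⟨max T T1, le_max_left _ _, le_antisymm (hT1 _ (le_max_right _ _)) (by omega)⟩
  · have := Filter.frequently_lt_of_lt_limsup (u := fun i => G.colour (π i)) (b := C - 1) hcob
      (by rw [← hC]; omega)
    obtain ⟨t, ht, hlt⟩ := Filter.frequently_atTop.1 this (max T T1)
    have h2 := hT1 t ((le_max_right _ _).trans ht)
    exact ⟨t, (le_max_left _ _).trans ht, by omega⟩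

open Classical in
/-- A stack `g 0, …, g k` is extended by `v`; if this closes an even cycle, then that cycle is
removed. -/
noncomputable def pushStack (s : ℕ × (ℕ → V)) (v : V) : ℕ × (ℕ → V) :=
  let g := Function.update s.2 (s.1 + 1) v
  if h : ∃ x, G.EvenCycle g x (s.1 + 1) then (h.choose, g) else (s.1 + 1, g)

/-- The stack after a nonempty history. -/
noncomputable def stackOf (v₀ : V) (l : List V) : ℕ × (ℕ → V) :=
  l.tail.foldl G.pushStack (0, fun _ => v₀)

/-- The strategy that forgets the even cycles. -/
noncomputable def forgetful (v₀ : V) (σ : List V → V → V) (ρ : List V) (v : V) : V :=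
  let s := G.stackOf v₀ (ρ ++ [v])
  σ ((List.range s.1).map s.2) v

/-- The stack at time `t` of the play `π`. -/
noncomputable def stackAt (v₀ : V) (π : ℕ → V) (t : ℕ) : ℕ × (ℕ → V) :=
  G.stackOf v₀ ((List.range (t + 1)).map π)

lemma stackAt_succ (v₀ : V) (π : ℕ → V) (t : ℕ) :
    G.stackAt v₀ π (t + 1) = G.pushStack (G.stackAt v₀ π t) (π (t + 1)) := by
  unfold stackAt stackOf
  rw [List.range_succ, List.map_append, List.tail_append_of_ne_nil (by simp),
    List.foldl_append]
  rfl

lemma pushStack_snd (s : ℕ × (ℕ → V)) (v : V) :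
    (G.pushStack s v).2 = Function.update s.2 (s.1 + 1) v := by
  unfold pushStack
  simp only
  split_ifs <;> rfl

lemma pushStack_fst (s : ℕ × (ℕ → V)) (v : V) :
    G.EvenCycle (G.pushStack s v).2 (G.pushStack s v).1 (s.1 + 1) ∨
      ((G.pushStack s v).1 = s.1 + 1 ∧ ∀ x, ¬ G.EvenCycle (G.pushStack s v).2 x (s.1 + 1)) := by
  rw [pushStack_snd]
  unfold pushStack
  simp only
  split_ifs with h
  · exact Or.inl h.choose_spec
  · exact Or.inr ⟨rfl, not_exists.1 h⟩

lemma EvenCycle.congr {f g : ℕ → V} {x y : ℕ} (h : G.EvenCycle f x y) (hfg : ∀ i ≤ y, f i = g i) :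
    G.EvenCycle g x y := by
  obtain ⟨h1, h2, h3⟩ := h
  refine ⟨h1, by rw [← hfg x h1.le, ← hfg y le_rfl, h2], ?_⟩
  rwa [← segMax_congr (c := fun i => G.colour (f i)) fun i _ hi => by rw [hfg i (by omega)]]

/-- The stack is a play prefix that is consistent with `σ` and has no even cycle. -/
structure GoodStack (v₀ : V) (σ : List V → V → V) (v : V) (s : ℕ × (ℕ → V)) : Prop where
  zero : s.2 0 = v₀
  top : s.2 s.1 = v
  edge : ∀ i < s.1, G.edge (s.2 i) (s.2 (i + 1))
  consistent : ∀ i < s.1, s.2 i ∈ G.evenVertices →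
    s.2 (i + 1) = σ ((List.range i).map s.2) (s.2 i)
  no_cycle : ∀ x y, y ≤ s.1 → ¬ G.EvenCycle s.2 x y

variable {G} {v₀ : V} {σ : List V → V → V}

lemma map_range_congr {f g : ℕ → V} {n : ℕ} (h : ∀ i < n, f i = g i) :
    (List.range n).map f = (List.range n).map g :=
  List.map_congr_left fun i hi => h i (List.mem_range.1 hi)

lemma pushStack_fst_le (s : ℕ × (ℕ → V)) (v : V) : (G.pushStack s v).1 ≤ s.1 + 1 := by
  rcases G.pushStack_fst s v with h | h
  · exact h.1.le
  · exact h.1.le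

lemma pushStack_snd_of_le (s : ℕ × (ℕ → V)) (v : V) {i : ℕ} (hi : i ≤ s.1) :
    (G.pushStack s v).2 i = s.2 i := by
  rw [pushStack_snd, Function.update_of_ne (by omega)]

lemma pushStack_snd_top (s : ℕ × (ℕ → V)) (v : V) : (G.pushStack s v).2 (s.1 + 1) = v := by
  rw [pushStack_snd, Function.update_self]

/-- Cutting a cycle back to its first position leaves the same vertex `w` on top, above a prefix
that was already good. A new even cycle could only end at the pushed entry. -/
lemma GoodStack.push {v w : V} {s : ℕ × (ℕ → V)} (h : G.GoodStack v₀ σ v s) (he : G.edge v w)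
    (hc : v ∈ G.evenVertices → w = σ ((List.range s.1).map s.2) v) :
    G.GoodStack v₀ σ w (G.pushStack s w) := by
  have hle := pushStack_fst_le (G := G) s w
  have hold := fun i (hi : i ≤ s.1) => pushStack_snd_of_le (G := G) s w hi
  have htop := pushStack_snd_top (G := G) s w
  have hcyc := G.pushStack_fst s w
  generalize G.pushStack s w = s' at *
  refine ⟨by rw [hold 0 (by omega), h.zero], ?_, ?_, ?_, ?_⟩
  · rcases hcyc with hcyc | hcyc
    · rw [hcyc.2.1, htop]
    · rw [hcyc.1, htop]
  · intro i hi
    rw [hold i (by omega)]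
    rcases Nat.lt_or_ge i s.1 with hlt | hge
    · rw [hold (i + 1) hlt]
      exact h.edge i hlt
    · obtain rfl : i = s.1 := by omega
      rwa [htop, h.top]
  · intro i hi hev
    rw [map_range_congr (g := s.2) fun k hk => hold k (by omega)]
    rw [hold i (by omega)] at hev ⊢
    rcases Nat.lt_or_ge i s.1 with hlt | hge
    · rw [hold (i + 1) hlt]
      exact h.consistent i hlt hev
    · obtain rfl : i = s.1 := by omega
      rw [htop]
      rw [h.top] at hev ⊢
      exact hc hev
  · intro x y hy hxy
    rcases Nat.lt_or_ge s.1 y with hlt | hge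
    · obtain rfl : y = s.1 + 1 := by omega
      rcases hcyc with hcyc | hcyc
      · have := hcyc.1
        omega
      · exact hcyc.2 x hxy
    · exact h.no_cycle x y hge (EvenCycle.congr G hxy fun i hi => hold i (by omega))

lemma goodStack_stackAt {π : ℕ → V} (hπ : G.IsPlay v₀ π)
    (hc : G.Consistent (G.forgetful v₀ σ) π) (t : ℕ) :
    G.GoodStack v₀ σ (π t) (G.stackAt v₀ π t) := by
  induction t with
  | zero =>
    have h0 : G.stackAt v₀ π 0 = (0, fun _ => v₀) := rfl
    rw [h0]
    refine ⟨rfl, hπ.1.symm, by simp, by simp, ?_⟩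
    rintro x y hy ⟨hxy, -⟩
    simp only at hy
    omega
  | succ t ih =>
    rw [stackAt_succ]
    refine ih.push (hπ.2 t) fun hev => ?_
    rw [hc t hev]
    unfold forgetful stackAt
    rw [List.range_succ, List.map_append]
    rfl

/-- As long as the height of the stack is at least `i`, its entry at `i` does not change. -/
lemma stackAt_eq_of_le {π : ℕ → V} {T i : ℕ} (h : ∀ t ≥ T, i ≤ (G.stackAt v₀ π t).1) {t : ℕ}
    (ht : T ≤ t) : (G.stackAt v₀ π t).2 i = (G.stackAt v₀ π T).2 i := by
  induction t, ht using Nat.le_induction with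
  | base => rfl
  | succ t ht ih => rw [stackAt_succ, pushStack_snd_of_le _ _ (h t ht), ih]

/-- If all plays that are consistent with `σ` have an even cycle, then the height of the stack does
not tend to infinity. -/
lemma exists_frequently_stackAt_le {π : ℕ → V} (hσ : ∀ π, G.IsPlay v₀ π → G.Consistent σ π →
    ∃ x y, G.EvenCycle π x y) (hπ : G.IsPlay v₀ π) (hc : G.Consistent (G.forgetful v₀ σ) π) :
    ∃ k, ∀ T, ∃ t ≥ T, (G.stackAt v₀ π t).1 ≤ k := by
  by_contra hcon
  push Not at hcon
  choose T hT using hcon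
  -- The limit of the stacks: from time `T i` on the height exceeds `i`, so entry `i` is frozen.
  set f : ℕ → V := fun i => (G.stackAt v₀ π (T i)).2 i with hf
  have key : ∀ n, ∃ t, n < (G.stackAt v₀ π t).1 ∧ ∀ i ≤ n, (G.stackAt v₀ π t).2 i = f i := by
    intro n
    refine ⟨(Finset.range (n + 1)).sup T, ?_, fun i hi => ?_⟩
    · exact hT n _ (Finset.le_sup (f := T) (by simp))
    · exact stackAt_eq_of_le (fun t ht => (hT i t ht).le) (Finset.le_sup (f := T) (by simp; omega))
  obtain ⟨x, y, hxy⟩ := hσ f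
    ⟨by
      obtain ⟨t, -, ht⟩ := key 0
      rw [← ht 0 le_rfl, (goodStack_stackAt hπ hc t).zero], fun n => by
      obtain ⟨t, h1, ht⟩ := key (n + 1)
      rw [← ht n (by omega), ← ht (n + 1) le_rfl]
      exact (goodStack_stackAt hπ hc t).edge n (by omega)⟩
    (fun n hn => by
      obtain ⟨t, h1, ht⟩ := key (n + 1)
      rw [map_range_congr (g := (G.stackAt v₀ π t).2) fun i hi => (ht i (by omega)).symm]
      rw [← ht n (by omega)] at hn ⊢
      rw [← ht (n + 1) le_rfl]
      exact (goodStack_stackAt hπ hc t).consistent n (by omega) hn)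
  obtain ⟨t, h1, ht⟩ := key y
  exact (goodStack_stackAt hπ hc t).no_cycle x y h1.le
    (EvenCycle.congr G hxy fun i hi => (ht i hi).symm)

lemma even_limsup_of_forgetful {π : ℕ → V} (hσ : ∀ π, G.IsPlay v₀ π →
    G.Consistent σ π → ∃ x y, G.EvenCycle π x y) (hπ : G.IsPlay v₀ π)
    (hc : G.Consistent (G.forgetful v₀ σ) π) :
    Even (Filter.limsup (fun i => G.colour (π i)) Filter.atTop) := by
  classical
  obtain ⟨⟨T, hT⟩, hfreq⟩ := G.limsup_colour π
  generalize Filter.limsup (fun i => G.colour (π i)) Filter.atTop = C at *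
  by_contra hodd
  have hex := exists_frequently_stackAt_le hσ hπ hc
  -- `H` is the limes inferior of the heights.
  obtain ⟨H, hH, hmin⟩ : ∃ H, (∀ T, ∃ t ≥ T, (G.stackAt v₀ π t).1 ≤ H) ∧
      ∃ T, ∀ t ≥ T, H ≤ (G.stackAt v₀ π t).1 := by
    refine ⟨Nat.find hex, Nat.find_spec hex, ?_⟩
    rcases Nat.eq_zero_or_pos (Nat.find hex) with h0 | hpos
    · exact ⟨0, fun t _ => by omega⟩
    · have := Nat.find_min hex (m := Nat.find hex - 1) (by omega)
      push Not at this
      obtain ⟨T, hT⟩ := this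
      exact ⟨T, fun t ht => by have := hT t ht; omega⟩
  obtain ⟨T', hT'⟩ := hmin
  obtain ⟨t₀, ht₀, hle⟩ := hH (max T T')
  have htT : T ≤ t₀ := (le_max_left _ _).trans ht₀
  have htT' : T' ≤ t₀ := (le_max_right _ _).trans ht₀
  have heq : (G.stackAt v₀ π t₀).1 = H := le_antisymm hle (hT' t₀ htT')
  -- Invariant: from height `H` upwards all colours are at most `C`, and once `C` has been read
  -- after `t₀`, it stays on the stack strictly above `H`.
  have key : ∀ t ≥ t₀, (∀ i, H ≤ i → i ≤ (G.stackAt v₀ π t).1 →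
      G.colour ((G.stackAt v₀ π t).2 i) ≤ C) ∧
      ((∃ s, t₀ < s ∧ s ≤ t ∧ G.colour (π s) = C) →
        ∃ i, H < i ∧ i ≤ (G.stackAt v₀ π t).1 ∧ G.colour ((G.stackAt v₀ π t).2 i) = C) := by
    intro t ht
    induction t, ht using Nat.le_induction with
    | base =>
      refine ⟨fun i h1 h2 => ?_, fun ⟨s, h1, h2, _⟩ => by omega⟩
      obtain rfl : i = (G.stackAt v₀ π t₀).1 := by omega
      rw [(goodStack_stackAt hπ hc t₀).top]
      exact hT t₀ htT
    | succ t ht ih =>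
      obtain ⟨ih1, ih2⟩ := ih
      have hlow := hT' t (by omega)
      have hlow' := hT' (t + 1) (by omega)
      have hC := hT (t + 1) (by omega)
      rw [stackAt_succ] at hlow' ⊢
      have hle := pushStack_fst_le (G := G) (G.stackAt v₀ π t) (π (t + 1))
      have hold := fun i (hi : i ≤ (G.stackAt v₀ π t).1) =>
        pushStack_snd_of_le (G := G) (G.stackAt v₀ π t) (π (t + 1)) hi
      have htop := pushStack_snd_top (G := G) (G.stackAt v₀ π t) (π (t + 1))
      have hcyc := G.pushStack_fst (G.stackAt v₀ π t) (π (t + 1))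
      generalize G.pushStack (G.stackAt v₀ π t) (π (t + 1)) = s' at *
      generalize G.stackAt v₀ π t = s at *
      have hall : ∀ i, H ≤ i → i ≤ s.1 + 1 → G.colour (s'.2 i) ≤ C := by
        intro i h1 h2
        rcases Nat.lt_or_ge s.1 i with hlt | hge
        · obtain rfl : i = s.1 + 1 := by omega
          rwa [htop]
        · rw [hold i hge]
          exact ih1 i h1 hge
      refine ⟨fun i h1 h2 => hall i h1 (by omega), ?_⟩
      rintro ⟨r, h1, h2, h3⟩
      obtain ⟨i, hi1, hi2, hi3⟩ : ∃ i, H < i ∧ i ≤ s.1 + 1 ∧ G.colour (s'.2 i) = C := by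
        rcases Nat.lt_or_ge t r with hlt | hge
        · obtain rfl : r = t + 1 := by omega
          exact ⟨s.1 + 1, by omega, le_rfl, by rw [htop, h3]⟩
        · obtain ⟨i, hi1, hi2, hi3⟩ := ih2 ⟨r, h1, hge, h3⟩
          exact ⟨i, hi1, by omega, by rw [hold i hi2, hi3]⟩
      refine ⟨i, hi1, ?_, hi3⟩
      rcases hcyc with ⟨-, -, hev⟩ | hcyc
      -- Removing the entry `i` of colour `C` would need an even cycle through `i` at heights at
      -- least `H`; its maximum would be `C`, which is odd.
      · by_contra hlt
        refine hodd ?_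
        convert hev using 1
        refine le_antisymm ?_ (Finset.sup_le fun k hk => ?_)
        · rw [← hi3]
          exact Finset.le_sup (f := fun i => G.colour (s'.2 i))
            (by rw [Finset.mem_Ico]; omega)
        · rw [Finset.mem_Ico] at hk
          exact hall k (by omega) (by omega)
      · omega
  obtain ⟨s, hs, hsC⟩ := hfreq (t₀ + 1)
  obtain ⟨t, ht, htH⟩ := hH s
  obtain ⟨i, h1, h2, -⟩ := (key t (by omega)).2 ⟨s, by omega, ht, hsC⟩
  omega

/-- If player even can enforce an even cycle, then he wins the parity game. -/
lemma evenWinsParity_of_evenWinsStopping {W : List V → Prop}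
    (hW : ∀ (f : ℕ → V) n, W ((List.range (n + 1)).map f) → ∃ x y, G.EvenCycle f x y)
    (h : G.EvenWinsStopping W v₀) : G.EvenWinsParity v₀ := by
  obtain ⟨σ, halt, hσ, hwin⟩ := h
  refine ⟨G.forgetful v₀ σ, fun ρ v hv => hσ _ v hv, fun π hπ hc => ?_⟩
  refine even_limsup_of_forgetful (fun π hπ hc => ?_) hπ hc
  obtain ⟨n, -, -, hn⟩ := hwin π hπ hc
  exact hW π n hn

end ParityGame
-- A potential with respect to an even colour
namespace WitnessSeq

/-- A number less than `c` at position `i`. -/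
def LowAt (c : ℕ) (b : WitnessSeq) (i : ℕ) : Prop := ∃ x, b.entry i = some x ∧ x < c

/-- The positions that count for the potential with respect to `c`: the positions of even numbers
that are at least `c`, and the greatest position of a number less than `c` unless it is `0`; nothing
counts to the right of a number less than `c`. -/
def Counts (c : ℕ) (b : WitnessSeq) (i : ℕ) : Prop :=
  (∀ j, i < j → ¬ b.LowAt c j) ∧ ((∃ x, b.entry i = some x ∧ c ≤ x ∧ Even x) ∨
    (b.LowAt c i ∧ i ≠ 0))

open Classical in
/-- The positions less than `N` that count, as a binary number. -/
noncomputable def weight (N c : ℕ) (b : WitnessSeq) : ℕ :=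
  ∑ i ∈ (Finset.range N).filter (b.Counts c), 2 ^ i

open Classical in
/-- The potential of a sequence with respect to the even colour `c`. -/
noncomputable def potential (N c : ℕ) (b : WitnessSeq) : ℕ :=
  2 * b.weight N c + if ∀ i, b.LowAt c i → i = 0 then 1 else 0

variable {N c d j : ℕ} {b b' : WitnessSeq}

lemma sum_two_pow_lt (s : Finset ℕ) (j : ℕ) (h : ∀ i ∈ s, i < j) : ∑ i ∈ s, 2 ^ i < 2 ^ j :=
  Nat.geomSum_lt le_rfl h

lemma weight_lt (N c : ℕ) (b : WitnessSeq) : b.weight N c < 2 ^ N :=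
  sum_two_pow_lt _ _ fun i hi => by simp at hi; exact hi.1

lemma potential_lt (N c : ℕ) (b : WitnessSeq) : b.potential N c < 2 * 2 ^ N := by
  have := weight_lt N c b
  unfold potential
  split_ifs <;> omega

lemma weight_mono (h : ∀ i, b.Counts c i → b'.Counts c i) : b.weight N c ≤ b'.weight N c := by
  classical
  unfold weight
  refine Finset.sum_le_sum_of_subset fun i hi => ?_
  simp only [Finset.mem_filter] at hi ⊢
  exact ⟨hi.1, h i hi.2⟩

lemma weight_lt_weight (hjN : j < N) (hj : ¬ b.Counts c j) (hj' : b'.Counts c j)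
    (h : ∀ i, j < i → b.Counts c i → b'.Counts c i) : b.weight N c < b'.weight N c := by
  classical
  unfold weight
  -- The two sums are split differently, at `< j` and at `≤ j`: the bits lost below `j` total less
  -- than the bit `2 ^ j` gained.
  rw [← Finset.sum_filter_add_sum_filter_not ((Finset.range N).filter (b.Counts c)) (· < j),
    ← Finset.sum_filter_add_sum_filter_not ((Finset.range N).filter (b'.Counts c)) (· ≤ j)]
  refine Nat.add_lt_add_of_lt_of_le ?_ ?_
  · refine (sum_two_pow_lt _ j fun i hi => (Finset.mem_filter.1 hi).2).trans_le ?_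
    exact Finset.single_le_sum (f := fun i => 2 ^ i) (fun _ _ => Nat.zero_le _)
      (by simp [hjN, hj'])
  · refine Finset.sum_le_sum_of_subset fun i hi => ?_
    simp only [Finset.mem_filter, not_lt, not_le] at hi ⊢
    have hne : i ≠ j := by
      rintro rfl
      exact hj hi.1.2
    have hlt : j < i := lt_of_le_of_ne hi.2 hne.symm
    exact ⟨⟨hi.1.1, h i hlt hi.1.2⟩, hlt⟩

/-- Even entries survive truncation. So does the leftmost entry below `c`, since an equal entry
further left would also be below `c`. -/
lemma potential_trunc (N c : ℕ) (b : WitnessSeq) :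
    b.potential N c ≤ b.trunc.potential N c := by
  classical
  have hent : ∀ i x, b.trunc.entry i = some x → b.entry i = some x := by
    intro i x hx
    simp only [trunc] at hx
    split_ifs at hx
    exact hx
  have hlow : ∀ i, b.trunc.LowAt c i → b.LowAt c i := fun i ⟨x, hx, hlt⟩ => ⟨x, hent i x hx, hlt⟩
  have hc : ∀ i, b.Counts c i → b.trunc.Counts c i := by
    rintro i ⟨h1, h2⟩
    refine ⟨fun j hj hl => h1 j hj (hlow j hl), ?_⟩
    rcases h2 with ⟨x, hx, hcx, he⟩ | ⟨⟨x, hx, hlt⟩, hi⟩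
    · refine Or.inl ⟨x, ?_, hcx, he⟩
      simp only [trunc]
      rw [if_neg, hx]
      rintro ⟨⟨y, hy, ho⟩, -⟩
      rw [hx] at hy
      cases hy
      exact (Nat.not_odd_iff_even.2 he) ho
    · refine Or.inr ⟨⟨x, ?_, hlt⟩, hi⟩
      simp only [trunc]
      rw [if_neg, hx]
      rintro ⟨-, j, hj, hjx⟩
      exact h1 j hj ⟨x, by rw [hjx, hx], hlt⟩
  have hw := weight_mono (N := N) hc
  unfold potential
  split_ifs with h1 h2
  · omega
  · exact absurd (fun i hi => h1 i (hlow i hi)) h2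
  · omega
  · omega

/-- Facts that are enough for an increase of the potential. -/
lemma potential_le_of_counts (hc : ∀ i, b.Counts c i → b'.Counts c i)
    (hl : (∀ i, b.LowAt c i → i = 0) → ∀ i, b'.LowAt c i → i = 0) :
    b.potential N c ≤ b'.potential N c := by
  have hw := weight_mono (N := N) hc
  unfold potential
  split_ifs with h1 h2
  · omega
  · exact absurd (hl h1) h2
  · omega
  · omega

/-- For the case that `c` replaces the leftmost entry below `c`, at a position other than `0`: the
bit there was set already, and only the extra summand `1` registers progress. -/
lemma potential_lt_of_counts (hc : ∀ i, b.Counts c i → b'.Counts c i)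
    (hl : ¬ ∀ i, b.LowAt c i → i = 0) (hl' : ∀ i, b'.LowAt c i → i = 0) :
    b.potential N c < b'.potential N c := by
  have hw := weight_mono (N := N) hc
  unfold potential
  rw [if_neg hl, if_pos hl']
  omega

/-- The factor `2` lets any gain in weight outweigh a loss of the summand `1`. -/
lemma potential_lt_of_weight_lt (h : b.weight N c < b'.weight N c) :
    b.potential N c < b'.potential N c := by
  unfold potential
  split_ifs <;> omega

lemma overwrite_above (b : WitnessSeq) {x : Option ℕ} {i : ℕ} (h : j < i) :
    (b.overwrite j x).entry i = b.entry i := by simp [overwrite_entry, h]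

lemma overwrite_at (b : WitnessSeq) {x : Option ℕ} : (b.overwrite j x).entry j = x := by
  simp [overwrite_entry]

lemma overwrite_below (b : WitnessSeq) {x : Option ℕ} {i : ℕ} (h : i < j) :
    (b.overwrite j x).entry i = none := by
  simp [overwrite_entry, h.not_gt, h.ne]

lemma lowAt_congr {i : ℕ} (h : b.entry i = b'.entry i) : b.LowAt c i ↔ b'.LowAt c i := by
  simp [LowAt, h]

lemma counts_overwrite_above {x : Option ℕ} {i : ℕ} (h : j < i) :
    b.Counts c i ↔ (b.overwrite j x).Counts c i := by
  unfold Counts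
  rw [overwrite_above b h, lowAt_congr (c := c) (overwrite_above b (x := x) h)]
  refine and_congr_left fun _ => forall₂_congr fun k hk => ?_
  rw [lowAt_congr (c := c) (overwrite_above b (x := x) (h.trans hk))]

/-- An overwriting to the right of a number less than `c` does not decrease the potential. -/
lemma potential_le_overwrite_of_lowAt {x : Option ℕ} {k : ℕ} (hk : b.LowAt c k) (hjk : j < k) :
    b.potential N c ≤ (b.overwrite j x).potential N c := by
  refine potential_le_of_counts (fun i hi => ?_) fun h => ?_
  · rcases Nat.lt_or_ge j i with h | h
    · exact (counts_overwrite_above h).1 hi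
    · exact absurd hk (hi.1 k (by omega))
  · have := h k hk
    omega

lemma not_lowAt_above (hge : b.GeAbove c j) {i : ℕ} (h : j < i) : ¬ b.LowAt c i := by
  rintro ⟨x, hx, hlt⟩
  have := hge i h x hx
  omega

lemma not_lowAt_overwrite_self (hge : b.GeAbove c j) (i : ℕ) :
    ¬ (b.overwrite j (some c)).LowAt c i := by
  rcases lt_trichotomy j i with h | rfl | h
  · rw [lowAt_congr (overwrite_above b h)]
    exact not_lowAt_above hge h
  · rintro ⟨x, hx, hlt⟩
    rw [overwrite_at] at hx
    cases hx
    omega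
  · rintro ⟨x, hx, hlt⟩
    simp [overwrite_below b h] at hx

lemma counts_overwrite_self (hc : Even c) (hge : b.GeAbove c j) :
    (b.overwrite j (some c)).Counts c j :=
  ⟨fun i _ => not_lowAt_overwrite_self hge i, Or.inl ⟨c, overwrite_at b, le_rfl, hc⟩⟩

lemma counts_imp_of_lowAt {x : Option ℕ} (hl : b.LowAt c j)
    (hj : b.Counts c j → (b.overwrite j x).Counts c j) (i : ℕ) (hi : b.Counts c i) :
    (b.overwrite j x).Counts c i := by
  rcases lt_trichotomy j i with h | rfl | h
  · exact (counts_overwrite_above h).1 hi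
  · exact hj hi
  · exact absurd hl (hi.1 j h)

lemma lowAt_of_counts_of_not_even (hj : b.OddAt j ∨ b.entry j = none) (h : b.Counts c j) :
    b.LowAt c j ∧ j ≠ 0 := by
  rcases h.2 with ⟨x, hx, -, he⟩ | h
  · rcases hj with ⟨y, hy, ho⟩ | hj
    · rw [hx] at hy
      cases hy
      exact absurd ho (Nat.not_odd_iff_even.2 he)
    · simp [hx] at hj
  · exact h

/-- The overflow rule for the colour `c` itself. -/
lemma potential_lt_overflow (hN : j < N) (h : b.OverflowAt c j) :
    b.potential N c < (b.overwrite j (some c)).potential N c := by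
  obtain ⟨hc, -, hj, hge⟩ := h
  by_cases hcj : b.Counts c j
  · obtain ⟨hl, h0⟩ := lowAt_of_counts_of_not_even hj hcj
    exact potential_lt_of_counts (counts_imp_of_lowAt hl fun _ => counts_overwrite_self hc hge)
      (fun h => h0 (h j hl)) fun i hi => absurd hi (not_lowAt_overwrite_self hge i)
  · exact potential_lt_of_weight_lt (weight_lt_weight hN hcj (counts_overwrite_self hc hge)
      fun i hi => (counts_overwrite_above hi).1)

/-- Overwriting with a colour less than `c`, with no number less than `c` to the left. -/
lemma counts_overwrite_of_lt (hd : d < c) (hl : ∀ i, j < i → ¬ b.LowAt c i) (h0 : j ≠ 0) :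
    (b.overwrite j (some d)).Counts c j :=
  ⟨fun i hi => by
    rw [lowAt_congr (overwrite_above b hi)]
    exact hl i hi, Or.inr ⟨⟨d, overwrite_at b, hd⟩, h0⟩⟩

/-- Overwriting position `0` does not decrease the potential if it does not count. -/
lemma potential_le_overwrite_zero {x : Option ℕ} (h : ¬ b.Counts c 0) :
    b.potential N c ≤ (b.overwrite 0 x).potential N c := by
  refine potential_le_of_counts (fun i hi => ?_) fun hl i hi => ?_
  · rcases Nat.eq_zero_or_pos i with rfl | hpos
    · exact absurd hi h
    · exact (counts_overwrite_above hpos).1 hi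
  · by_contra hne
    rw [lowAt_congr (overwrite_above b (Nat.pos_of_ne_zero hne))] at hi
    exact hne (hl i hi)

/-- To the right of an entry below `c` nothing counts, and position `0` did not count as it was odd
or blank. Otherwise the new entry `d` makes `j` count; if `j` counted before, it held an entry below
`c`, so nothing to its right is lost. -/
lemma potential_le_overflow (hN : j < N) (hd : d < c) (h : b.OverflowAt d j) :
    b.potential N c ≤ (b.overwrite j (some d)).potential N c := by
  obtain ⟨-, -, hj, hge⟩ := h
  by_cases hlow : ∃ k, j < k ∧ b.LowAt c k
  · obtain ⟨k, hk, hl⟩ := hlow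
    exact potential_le_overwrite_of_lowAt hl hk
  push Not at hlow
  rcases Nat.eq_zero_or_pos j with rfl | hpos
  · exact potential_le_overwrite_zero fun h => (lowAt_of_counts_of_not_even hj h).2 rfl
  have hj' := counts_overwrite_of_lt (b := b) hd hlow hpos.ne'
  by_cases hcj : b.Counts c j
  · obtain ⟨hl, h0⟩ := lowAt_of_counts_of_not_even hj hcj
    exact potential_le_of_counts (counts_imp_of_lowAt hl fun _ => hj') fun h => absurd (h j hl) h0
  · exact (potential_lt_of_weight_lt (weight_lt_weight hN hcj hj'
      fun i hi => (counts_overwrite_above hi).1)).le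

lemma potential_le_local (hd : d < c) (h : b.LocalAt d j) :
    b.potential N c ≤ (b.overwrite j (if j = 0 then none else some d)).potential N c := by
  obtain ⟨⟨y, hy, hyd⟩, hge⟩ := h
  have hl : b.LowAt c j := ⟨y, hy, hyd.trans hd⟩
  by_cases hlow : ∃ k, j < k ∧ b.LowAt c k
  · obtain ⟨k, hk, hl⟩ := hlow
    exact potential_le_overwrite_of_lowAt hl hk
  push Not at hlow
  rcases Nat.eq_zero_or_pos j with rfl | hpos
  · refine potential_le_overwrite_zero fun h => ?_
    rcases h.2 with ⟨x, hx, hcx, -⟩ | h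
    · rw [hy] at hx
      cases hx
      omega
    · exact h.2 rfl
  · rw [if_neg hpos.ne']
    exact potential_le_of_counts
      (counts_imp_of_lowAt hl fun _ => counts_overwrite_of_lt (b := b) hd hlow hpos.ne')
      fun h => absurd (h j hl) hpos.ne'

/-- The overflow rule applies at the first position that does not have an even number, unless there
is a number less than `d` to the left of it. -/
lemma exists_overflowAt_or (b : WitnessSeq) (hd : Even d) :
    ∃ k, (∀ i < k, b.EvenAt i) ∧ ¬ b.EvenAt k ∧ (b.OverflowAt d k ∨ ¬ b.GeAbove d k) := by
  classical
  have hex : ∃ k, ¬ b.EvenAt k := by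
    by_contra hcon
    push Not at hcon
    refine Set.infinite_univ (b.finite_entry.subset fun i _ => ?_)
    obtain ⟨x, hx, _⟩ := hcon i
    simp [hx]
  refine ⟨Nat.find hex, fun i hi => not_not.1 (Nat.find_min hex hi), Nat.find_spec hex, ?_⟩
  by_cases hge : b.GeAbove d (Nat.find hex)
  · refine Or.inl ⟨hd, fun i hi => not_not.1 (Nat.find_min hex hi), ?_, hge⟩
    have := Nat.find_spec hex
    rcases hx : b.entry (Nat.find hex) with _ | x
    · exact Or.inr rfl
    · refine Or.inl ⟨x, hx, Nat.not_even_iff_odd.1 fun he => this ⟨x, hx, he⟩⟩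
  · exact Or.inr hge

lemma GeAbove.mono {k : ℕ} (h : b.GeAbove d j) (hjk : j ≤ k) : b.GeAbove d k :=
  fun i hi => h i (by omega)

/-- The erasing case `j = 0` cannot occur: then no entry above `0` would be less than `c`, and
overflow would apply. -/
lemma potential_lt_local (hc : Even c) (h : b.LocalAt c j) (hno : ¬ ∃ j, b.OverflowAt c j) :
    b.potential N c < (b.overwrite j (if j = 0 then none else some c)).potential N c := by
  obtain ⟨hl, hge⟩ := h
  obtain ⟨k, -, -, hk | hk⟩ := b.exists_overflowAt_or hc
  · exact absurd ⟨k, hk⟩ hno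
  have hj : j ≠ 0 := by
    rintro rfl
    exact hk (hge.mono (Nat.zero_le k))
  rw [if_neg hj]
  exact potential_lt_of_counts (counts_imp_of_lowAt hl fun _ => counts_overwrite_self hc hge)
    (fun h => hj (h j hl)) fun i hi => absurd hi (not_lowAt_overwrite_self hge i)

lemma exists_overflowAt_or_localAt (b : WitnessSeq) (hc : Even c) :
    (∃ j, b.OverflowAt c j) ∨ ∃ j, b.LocalAt c j := by
  obtain ⟨k, -, -, hk | hk⟩ := b.exists_overflowAt_or hc
  · exact Or.inl ⟨k, hk⟩
  · unfold GeAbove at hk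
    push Not at hk
    obtain ⟨i, -, x, hx, hlt⟩ := hk
    obtain ⟨j, -, hj⟩ := exists_localAt hx hlt
    exact Or.inr ⟨j, hj⟩

/-- The positions of a sequence are bounded by its value. -/
lemma two_pow_le_val {i : ℕ} (h : b.entry i ≠ none) : 2 ^ i ≤ b.val := by
  -- Take the greatest odd position if some odd position is at least `i`; otherwise `i` itself holds
  -- an even number and is relevant.
  obtain ⟨k, hik, hk⟩ : ∃ k, i ≤ k ∧ k ∈ b.relevant := by
    by_cases ho : ∃ o, i ≤ o ∧ b.OddAt o
    · obtain ⟨o, hio, ho⟩ := ho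
      have hfin : {o | b.OddAt o}.Finite := b.finite_entry.subset fun i ⟨x, hx, _⟩ => by simp [hx]
      obtain ⟨k, hk, hmax⟩ := hfin.exists_le_maximal ho
      refine ⟨k, hio.trans hk, Or.inr ⟨hmax.1, fun l hl => ?_⟩⟩
      by_contra hlt
      exact hlt (hmax.2 hl (not_le.1 hlt).le)
    · push Not at ho
      obtain ⟨x, hx⟩ := Option.ne_none_iff_exists'.1 h
      refine ⟨i, le_rfl, Or.inl ⟨⟨x, hx, ?_⟩, fun o hodd => ?_⟩⟩
      · by_contra hne
        exact ho i le_rfl ⟨x, hx, Nat.not_even_iff_odd.1 hne⟩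
      · by_contra hlt
        exact ho o (not_lt.1 hlt) hodd
  rw [val_eq_sum]
  calc 2 ^ i ≤ 2 ^ k := Nat.pow_le_pow_right (by norm_num) hik
    _ ≤ _ := Finset.single_le_sum (f := fun i => 2 ^ i) (fun _ _ => Nat.zero_le _)
      ((Set.Finite.mem_toFinset _).2 hk)

end WitnessSeq

/-! ### Completeness: many occurrences of an even maximum lead to `won` -/

namespace ParityGame

variable {V : Type*} (G : ParityGame V)

/-- Guarantees that no reset happens while colours at most `c` are read. -/
lemma colour_mem_coloursMinus {v : V} {c : ℕ} (hc : Even c) (hcm : c ≤ G.maxColour)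
    (hv : G.colour v ≤ c) : G.colour v ∈ G.coloursMinus := by
  unfold coloursMinus
  split_ifs with h
  · refine Finset.mem_erase.2 ⟨?_, G.colour_mem v⟩
    intro heq
    have : c = G.maxColour := by omega
    rw [this] at hc
    exact (Nat.not_odd_iff_even.2 hc) h
  · exact G.colour_mem v

lemma potential_rawUpdateClassic_le {c d N : ℕ} {b : WitnessSeq} (hd : d < c)
    (hmem : d ∈ G.coloursMinus) (hN : ∀ i, (G.rawUpdateClassic b d).entry i ≠ none → i < N) :
    b.potential N c ≤ (G.rawUpdateClassic b d).potential N c := by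
  by_cases h1 : ∃ j, b.OverflowAt d j
  · have heq : G.rawUpdateClassic b d = b.overwrite h1.choose (some d) := by
      rw [rawUpdateClassic, if_pos hmem, dif_pos h1]
    rw [heq] at hN ⊢
    exact WitnessSeq.potential_le_overflow
      (hN _ (by rw [WitnessSeq.overwrite_at]; exact Option.some_ne_none d)) hd h1.choose_spec
  by_cases h2 : ∃ j, b.LocalAt d j
  · have heq : G.rawUpdateClassic b d =
        b.overwrite h2.choose (if h2.choose = 0 then none else some d) := by
      rw [rawUpdateClassic, if_pos hmem, dif_neg h1, dif_pos h2]
    rw [heq]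
    exact WitnessSeq.potential_le_local hd h2.choose_spec
  · have heq : G.rawUpdateClassic b d = b := by
      rw [rawUpdateClassic, if_pos hmem, dif_neg h1, dif_neg h2]
    rw [heq]

lemma potential_rawUpdateClassic_lt {c N : ℕ} {b : WitnessSeq} (hc : Even c)
    (hmem : c ∈ G.coloursMinus) (hN : ∀ i, (G.rawUpdateClassic b c).entry i ≠ none → i < N) :
    b.potential N c < (G.rawUpdateClassic b c).potential N c := by
  by_cases h1 : ∃ j, b.OverflowAt c j
  · have heq : G.rawUpdateClassic b c = b.overwrite h1.choose (some c) := by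
      rw [rawUpdateClassic, if_pos hmem, dif_pos h1]
    rw [heq] at hN ⊢
    exact WitnessSeq.potential_lt_overflow
      (hN _ (by rw [WitnessSeq.overwrite_at]; exact Option.some_ne_none c)) h1.choose_spec
  · have h2 := (b.exists_overflowAt_or_localAt hc).resolve_left h1
    have heq : G.rawUpdateClassic b c =
        b.overwrite h2.choose (if h2.choose = 0 then none else some c) := by
      rw [rawUpdateClassic, if_pos hmem, dif_neg h1, dif_pos h2]
    rw [heq]
    exact WitnessSeq.potential_lt_local hc h2.choose_spec h1

/-- Reading a colour that is at most `c` leads to `won`, or to a sequence whose potential is at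
least as great, and greater if the colour is `c`. -/
lemma update_eq_won_or {c : ℕ} (hc : Even c) (hcm : c ≤ G.maxColour) {v : V}
    (hv : G.colour v ≤ c) (b : WitnessSeq) :
    G.update (.seq b) (G.colour v) = .won ∨
      ∃ b', G.update (.seq b) (G.colour v) = .seq b' ∧
        b.potential (G.numEven + 1) c + (if G.colour v = c then 1 else 0) ≤
          b'.potential (G.numEven + 1) c := by
  have hmem := G.colour_mem_coloursMinus hc hcm hv
  generalize G.colour v = d at *
  by_cases hval : (G.rawUpdateClassic b d).val ≤ G.numEven
  · refine Or.inr ⟨(G.rawUpdateClassic b d).trunc, by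
      simp [update, updateClassic, hval, State.trunc], ?_⟩
    -- A crude bound on the length suffices: `i < 2 ^ i`, and `2 ^ i` is at most the value.
    have hN : ∀ i, (G.rawUpdateClassic b d).entry i ≠ none → i < G.numEven + 1 := fun i hi => by
      have h1 := WitnessSeq.two_pow_le_val hi
      have h2 := Nat.lt_two_pow_self (n := i)
      omega
    refine le_trans ?_ (WitnessSeq.potential_trunc _ c _)
    split_ifs with h
    · subst h
      exact G.potential_rawUpdateClassic_lt hc hmem hN
    · exact G.potential_rawUpdateClassic_le (lt_of_le_of_ne hv h) hmem hN
  · exact Or.inl (by simp [update, updateClassic, hval, State.trunc])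

lemma foldl_update_won (l : List V) :
    l.foldl (fun s v => G.update s (G.colour v)) .won = .won := by
  induction l with
  | nil => rfl
  | cons v l ih => exact ih

/-- After reading sufficiently many occurrences of an even colour `c`, and otherwise only colours
less than `c`, the state is `won`. -/
lemma foldl_update_eq_won {c : ℕ} (hc : Even c) (hcm : c ≤ G.maxColour) {l : List V}
    (hl : ∀ v ∈ l, G.colour v ≤ c)
    (hcount : 2 * 2 ^ (G.numEven + 1) ≤ l.countP fun v => G.colour v = c) (s : State) :
    l.foldl (fun s v => G.update s (G.colour v)) s = .won := by
  cases s with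
  | won => exact G.foldl_update_won l
  | seq b =>
    -- The reached sequence need not be identified: any `b'` of such a potential contradicts
    -- `potential_lt`.
    suffices h : ∀ (l : List V), (∀ v ∈ l, G.colour v ≤ c) → ∀ b : WitnessSeq,
        l.foldl (fun s v => G.update s (G.colour v)) (.seq b) = .won ∨
        ∃ b' : WitnessSeq, b.potential (G.numEven + 1) c +
          (l.countP fun v => G.colour v = c) ≤ b'.potential (G.numEven + 1) c by
      rcases h l hl b with h | ⟨b', hb'⟩
      · exact h
      · have := WitnessSeq.potential_lt (G.numEven + 1) c b'
        omega
    intro l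
    induction l with
    | nil => exact fun _ b => Or.inr ⟨b, by simp⟩
    | cons v l ih =>
      intro hl b
      rw [List.foldl_cons]
      rcases G.update_eq_won_or hc hcm (hl v (by simp)) b with h | ⟨b', h, hpot⟩
      · rw [h]
        exact Or.inl (G.foldl_update_won l)
      · rw [h]
        refine (ih (fun w hw => hl w (by simp [hw])) b').imp_right fun ⟨b'', h''⟩ => ⟨b'', ?_⟩
        rw [List.countP_cons]
        simp only [decide_eq_true_eq]
        omega

/-- A play whose colours have an even limes superior has a prefix that ends with a segment in which
the even colour `c` is the greatest one and occurs often. -/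
lemma exists_segment {π : ℕ → V}
    (h : Even (Filter.limsup (fun i => G.colour (π i)) Filter.atTop)) (B : ℕ) :
    ∃ c n, ∃ l l' : List V, Even c ∧ c ≤ G.maxColour ∧ (List.range (n + 1)).map π = l ++ l' ∧
      (∀ v ∈ l', G.colour v ≤ c) ∧ B ≤ l'.countP fun v => G.colour v = c := by
  obtain ⟨⟨T, hT⟩, hfreq⟩ := G.limsup_colour π
  generalize Filter.limsup (fun i => G.colour (π i)) Filter.atTop = c at *
  have hcm : c ≤ G.maxColour := by
    obtain ⟨t, -, ht⟩ := hfreq 0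
    exact ht ▸ G.colour_le_maxColour _
  have hcount : ∃ n, B ≤ ((List.range (n + 1)).map fun i => π (T + i)).countP
      fun v => G.colour v = c := by
    induction B with
    | zero => exact ⟨0, Nat.zero_le _⟩
    | succ B ih =>
      obtain ⟨n, hn⟩ := ih
      obtain ⟨t, ht, htc⟩ := hfreq (T + n + 1)
      obtain ⟨k, rfl⟩ := Nat.exists_eq_add_of_le ht
      refine ⟨n + 1 + k, ?_⟩
      rw [List.range_succ, List.map_append, List.countP_append]
      refine add_le_add (hn.trans ?_) ?_
      · refine List.Sublist.countP_le (List.Sublist.map _ ?_)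
        exact List.range_sublist.2 (by omega)
      · simp [← htc, Nat.add_assoc]
  obtain ⟨n, hn⟩ := hcount
  refine ⟨c, T + n, (List.range T).map π, (List.range (n + 1)).map fun i => π (T + i), h, hcm, ?_,
    ?_, hn⟩
  · rw [Nat.add_assoc, List.range_add, List.map_append, List.map_map]
    rfl
  · intro v hv
    obtain ⟨i, -, rfl⟩ := List.mem_map.1 hv
    exact hT _ (Nat.le_add_right T i)

variable {G} {v₀ : V}

lemma EvenWinsParity.evenWinsStopping {W : List V → Prop} (h : G.EvenWinsParity v₀)
    (hW : ∀ π : ℕ → V, Even (Filter.limsup (fun i => G.colour (π i)) Filter.atTop) →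
      ∃ n, W ((List.range (n + 1)).map π)) : G.EvenWinsStopping W v₀ := by
  classical
  obtain ⟨σ, hσ, hwin⟩ := h
  -- Keep the parity strategy and stop at the first prefix in `W`.
  refine ⟨σ, {ρ | W ρ}, hσ, fun π hπ hc => ?_⟩
  have hex := hW π (hwin π hπ hc)
  exact ⟨Nat.find hex, Nat.find_spec hex, fun m hm => Nat.find_min hex hm, Nat.find_spec hex⟩

lemma EvenWinsParity.evenWinsForward (h : G.EvenWinsParity v₀) :
    G.EvenWinsForward v₀ := by
  refine h.evenWinsStopping fun π hπ => ?_
  obtain ⟨c, n, l, l', hc, hcm, heq, hl, hcount⟩ :=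
    G.exists_segment hπ (2 * 2 ^ (G.numEven + 1))
  refine ⟨n, ?_⟩
  rw [heq, eval_append]
  exact G.foldl_update_eq_won hc hcm hl hcount _

lemma EvenWinsParity.evenWinsBackward (h : G.EvenWinsParity v₀) :
    G.EvenWinsBackward v₀ := by
  refine h.evenWinsStopping fun π hπ => ?_
  obtain ⟨c, n, l, l', hc, hcm, heq, hl, hcount⟩ :=
    G.exists_segment hπ (2 * 2 ^ (G.numEven + 1))
  refine ⟨n, ?_⟩
  rw [heq, List.reverse_append, eval_append, eval,
    G.foldl_update_eq_won hc hcm (fun v hv => hl v (List.mem_reverse.1 hv))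
      (by rwa [List.countP_reverse])]
  exact G.foldl_update_won _

end ParityGame
end ConciseWitness

theorem mainTheorem2 {V : Type*} [Finite V] (G : ConciseWitness.ParityGame V) (v₀ : V) :
    (G.EvenWinsForward v₀ ↔ G.EvenWinsParity v₀) ∧
      (G.EvenWinsBackward v₀ ↔ G.EvenWinsParity v₀) :=
  ⟨⟨ConciseWitness.ParityGame.evenWinsParity_of_evenWinsStopping fun f n hn => by
      obtain ⟨x, y, -, h⟩ := G.exists_evenCycle_of_eval_eq_won hn
      exact ⟨x, y, h⟩, fun h => h.evenWinsForward⟩,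
    ⟨ConciseWitness.ParityGame.evenWinsParity_of_evenWinsStopping fun f n hn => by
      obtain ⟨x, y, -, h⟩ := G.exists_evenCycle_of_eval_reverse_eq_won hn
      exact ⟨x, y, h⟩, fun h => h.evenWinsBackward⟩⟩
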